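/- **Conventions.** A ringed finite space is a ringed space $(X,\mathcal O_X)$ ($\mathcal O_X$ a sheaf of commutative rings with unit) whose underlying topological space is finite. For $p,q\in X$ write $p\le q$ if $p\in\overline{\{q\}}$, let $U_p=\{q: p\le q\}$ be the smallest open set containing $p$, and let $r_{pq}\colon\mathcal O_p\to\mathcal O_q$ (for $p\le q$) be the restriction morphism of stalks. Let $I=[0,1]$ and let $X\times I$ carry the sheaf of rings $\pi_X^{-1}\mathcal O_X$, where $\pi_X\colon X\times I\to X$ is the projection; for $t\in I$ let $i_t\colon X\to X\times I$ be the morphism of ringed spaces given by $x\mapsto (x,t)$ and the identity $i_t^{-1}\mathcal O_{X\times I}=\mathcal O_X$. Two morphisms of ringed spaces $f,g\colon X\to Y$ are homotopic, $f\sim g$, if there is a morphism of ringed spaces $H\colon X\times I\to Y$ with $H_0=f$ and $H_1=g$, where $H_t=H\circ i_t$. A morphism $f\colon X\to Y$ is a homotopy equivalence if there is a morphism $g\colon Y\to X$ with $g\circ f\sim \mathrm{Id}_X$ and $f\circ g\sim\mathrm{Id}_Y$; $X$ and $Y$ are homotopy equivalent if there is a homotopy equivalence $X\to Y$. A subset $S\subseteq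 X$, with inclusion $i\colon S\to X$, is regarded as a ringed space with the subspace topology and the sheaf $i^{-1}\mathcal O_X$; it is a strong deformation retract of $X$ if there are a morphism $r\colon X\to S$ with $r\circ i=\mathrm{Id}_S$ and a homotopy $H$ from $\mathrm{Id}_X$ to $i\circ r$ such that $H_t\circ i=i$ for all $t\in I$. A point $p$ of a ringed finite $T_0$-space $X$ is a down beat point if $\overline{\{p\}}\setminus\{p\}$ has a maximum, and an up beat point if $U_p\setminus\{p\}$ has a minimum $q$ and $r_{pq}\colon\mathcal O_p\to\mathcal O_q$ is an isomorphism. A minimal ringed finite space is a ringed finite $T_0$-space with no down beat points and no up beat points. A core of a ringed finite space $X$ is a strong deformation retract of $X$ that is a minimal ringed finite space. **Theorem (Classification Theorem).** 1. A homotopy equivalence between minimal ringed finite spaces is an isomorphism of ringed spaces. 2. Every ringed finite space has a core, and any two cores of a ringed finite space are isomorphic ringed spaces. 3. Let $X$ and $Y$ be ringed finite spaces, $S$ a core of $X$ and $T$ a core of $Y$. Then $X$ and $Y$ are homotopy equivalent if and only if $S$ and $T$ are isomorphic ringed spaces. -/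

import Mathlib

open CategoryTheory TopCat TopologicalSpace Opposite AlgebraicGeometry

-- so that `X ⟶ Y` is read through the category structure itself
attribute [-instance] CategoryTheory.catToReflQuiver

universe u

noncomputable section

namespace RingedFinite

/-! ## Inverse image ringed spaces -/

/-- For a continuous map `f : Z ⟶ X` into (the space underlying) a ringed space `X`, the ringed
space `(Z, f⁻¹ 𝒪_X)`. -/
def inverseImage (X : RingedSpace.{u, u}) {Z : TopCat.{u}} (f : Z ⟶ X.carrier) :
    RingedSpace.{u, u} where
  carrier := Z
  presheaf := ((Sheaf.pullback CommRingCat.{u} f).obj X.sheaf).obj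
  IsSheaf := ((Sheaf.pullback CommRingCat.{u} f).obj X.sheaf).property

/-- The canonical morphism `(Z, f⁻¹ 𝒪_X) ⟶ X`, given by `f` and the unit `𝒪_X ⟶ f_* f⁻¹ 𝒪_X`. -/
def inverseImageHom (X : RingedSpace.{u, u}) {Z : TopCat.{u}} (f : Z ⟶ X.carrier) :
    inverseImage X f ⟶ X :=
  InducedCategory.homMk
    { base := f
      c := ((Sheaf.pullbackPushforwardAdjunction CommRingCat.{u} f).unit.app X.sheaf).hom }

/-- A morphism of ringed spaces `φ : W ⟶ X` whose underlying map factors as `g ≫ f` with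
`g : W ⟶ Z` continuous induces a morphism `W ⟶ (Z, f⁻¹ 𝒪_X)` with underlying map `g`: its sheaf
part `f⁻¹ 𝒪_X ⟶ g_* 𝒪_W` is adjoint to `φ_# : 𝒪_X ⟶ φ_* 𝒪_W = f_* (g_* 𝒪_W)`. -/
def inverseImageLift {X W : RingedSpace.{u, u}} {Z : TopCat.{u}} (f : Z ⟶ X.carrier)
    (φ : W ⟶ X) (g : W.carrier ⟶ Z) (h : φ.hom.base = g ≫ f) : W ⟶ inverseImage X f :=
  InducedCategory.homMk
    { base := g
      c := (((Sheaf.pullbackPushforwardAdjunction CommRingCat.{u} f).homEquiv X.sheaf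
          ((Sheaf.pushforward CommRingCat.{u} g).obj W.sheaf)).symm
          (ObjectProperty.homMk
            (φ.hom.c ≫ (Presheaf.pushforwardEq h W.presheaf).hom))).hom }

/-- The induced morphism `W ⟶ (Z, f⁻¹ 𝒪_X)` composed with the canonical one is `φ`. -/
lemma inverseImageLift_comp {X W : RingedSpace.{u, u}} {Z : TopCat.{u}} (f : Z ⟶ X.carrier)
    (φ : W ⟶ X) (g : W.carrier ⟶ Z) (h : φ.hom.base = g ≫ f) :
    inverseImageLift f φ g h ≫ inverseImageHom X f = φ := by
  obtain ⟨⟨b, c⟩⟩ := φ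
  obtain rfl : b = g ≫ f := h
  have key := ((Sheaf.pullbackPushforwardAdjunction CommRingCat.{u} f).homEquiv X.sheaf
          ((Sheaf.pushforward CommRingCat.{u} g).obj W.sheaf)).apply_symm_apply
          (ObjectProperty.homMk (c ≫ (Presheaf.pushforwardEq rfl W.presheaf).hom))
  rw [Adjunction.homEquiv_unit] at key
  have hc : c ≫ (Presheaf.pushforwardEq rfl W.presheaf).hom = c := by
    refine NatTrans.ext (funext fun U => ?_)
    exact (congrArg (c.app U ≫ ·) (W.presheaf.map_id _)).trans (Category.comp_id _)
  refine congrArg InducedCategory.homMk ?_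
  refine PresheafedSpace.ext _ _ rfl ?_
  refine NatTrans.ext (funext fun U => ?_)
  refine (congrArg (_ ≫ ·) (W.presheaf.map_id _)).trans ((Category.comp_id _).trans ?_)
  exact congrArg (fun k => k.app U) ((congrArg (fun k => k.hom) key).trans hc)

/-- A morphism to `(Z, f⁻¹ 𝒪_X)` is determined by its underlying map and its composition with the
canonical morphism to `X`. -/
lemma inverseImage_hom_ext {X W : RingedSpace.{u, u}} {Z : TopCat.{u}} (f : Z ⟶ X.carrier)
    (a b : W ⟶ inverseImage X f) (hbase : a.hom.base = b.hom.base)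
    (hcomp : a ≫ inverseImageHom X f = b ≫ inverseImageHom X f) : a = b := by
  obtain ⟨⟨g, c⟩⟩ := a
  obtain ⟨⟨g', d⟩⟩ := b
  obtain rfl : g = g' := hbase
  change W.carrier ⟶ Z at g
  have h2 := PresheafedSpace.congr_app (congrArg (fun k => k.hom) hcomp)
  have : (ObjectProperty.homMk c : (Sheaf.pullback CommRingCat.{u} f).obj X.sheaf ⟶
      (Sheaf.pushforward CommRingCat.{u} g).obj W.sheaf) = ObjectProperty.homMk d := by
    apply ((Sheaf.pullbackPushforwardAdjunction CommRingCat.{u} f).homEquiv X.sheaf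
          ((Sheaf.pushforward CommRingCat.{u} g).obj W.sheaf)).injective
    refine ((Sheaf.pullbackPushforwardAdjunction CommRingCat.{u} f).homEquiv_unit _ _ _).trans
      (Eq.trans ?_ ((Sheaf.pullbackPushforwardAdjunction CommRingCat.{u} f).homEquiv_unit _ _ _).symm)
    refine ObjectProperty.hom_ext _ ?_
    refine NatTrans.ext (funext fun U => ?_)
    exact (h2 U).trans ((congrArg (_ ≫ ·) (W.presheaf.map_id _)).trans (Category.comp_id _))
  have hcd : c = d := congrArg (fun k => k.hom) this
  subst hcd
  rfl

/-! ## Homotopies of morphisms of ringed spaces -/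

/-- The projection `X × I → X`, with `I = [0, 1]`, as a continuous map. -/
def cylinderFst (X : RingedSpace.{u, u}) : TopCat.of (X.carrier × unitInterval) ⟶ X.carrier :=
  TopCat.ofHom ⟨Prod.fst, continuous_fst⟩

/-- The ringed space `X × I`: the product space, with the inverse image of `𝒪_X` under the
projection. -/
def cylinder (X : RingedSpace.{u, u}) : RingedSpace.{u, u} :=
  inverseImage X (cylinderFst X)

/-- The morphism `i_t : X ⟶ X × I`, given by `x ↦ (x, t)` and the identity of
`i_t⁻¹ 𝒪_{X × I} = 𝒪_X`. -/
def cylinderAt (X : RingedSpace.{u, u}) (t : unitInterval) : X ⟶ cylinder X :=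
  inverseImageLift (cylinderFst X) (𝟙 X)
    (TopCat.ofHom ⟨fun x => (x, t), by fun_prop⟩) rfl

/-- `f ∼ g`: there is a morphism of ringed spaces `H : X × I ⟶ Y` with `H_0 = f` and `H_1 = g`. -/
def Homotopic {X Y : RingedSpace.{u, u}} (f g : X ⟶ Y) : Prop :=
  ∃ H : cylinder X ⟶ Y, cylinderAt X 0 ≫ H = f ∧ cylinderAt X 1 ≫ H = g

/-- `f` is a homotopy equivalence: it has a homotopy inverse `g`. -/
def IsHomotopyEquiv {X Y : RingedSpace.{u, u}} (f : X ⟶ Y) : Prop :=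
  ∃ g : Y ⟶ X, Homotopic (f ≫ g) (𝟙 X) ∧ Homotopic (g ≫ f) (𝟙 Y)

/-- `X ∼ Y`: there is a homotopy equivalence `X ⟶ Y`. -/
def HomotopyEquivalent (X Y : RingedSpace.{u, u}) : Prop :=
  ∃ f : X ⟶ Y, IsHomotopyEquiv f

/-! ## Subspaces and strong deformation retracts -/

/-- A subset `S` of `X` as a ringed space: the subspace topology and the restriction (inverse
image) of `𝒪_X`. -/
def subspace (X : RingedSpace.{u, u}) (S : Set X.carrier) : RingedSpace.{u, u} :=
  inverseImage X (Z := TopCat.of S) (TopCat.ofHom ⟨Subtype.val, continuous_subtype_val⟩)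

/-- The inclusion morphism `S ⟶ X`. -/
def subspaceι (X : RingedSpace.{u, u}) (S : Set X.carrier) : subspace X S ⟶ X :=
  inverseImageHom X _

/-- `f` and `g` are homotopic relative to `S`: there is a homotopy `H` from `f` to `g` such that
`H_t` restricted to `S` equals `f` restricted to `S` for every `t`. -/
def HomotopicRel {X Y : RingedSpace.{u, u}} (f g : X ⟶ Y) (S : Set X.carrier) : Prop :=
  ∃ H : cylinder X ⟶ Y, cylinderAt X 0 ≫ H = f ∧ cylinderAt X 1 ≫ H = g ∧
    ∀ t : unitInterval, subspaceι X S ≫ cylinderAt X t ≫ H = subspaceι X S ≫ f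

/-- `S` is a strong deformation retract of `X`: there is a retraction `r : X ⟶ S` of the inclusion
`i : S ⟶ X` such that `i ∘ r` is homotopic to the identity of `X` relative to `S`. -/
def IsStrongDeformationRetract (X : RingedSpace.{u, u}) (S : Set X.carrier) : Prop :=
  ∃ r : X ⟶ subspace X S, subspaceι X S ≫ r = 𝟙 (subspace X S) ∧
    HomotopicRel (𝟙 X) (r ≫ subspaceι X S) S

/-! ## Beat points, minimal ringed finite spaces, cores

The preorder of a finite space is `p ≤ q ↔ p ∈ closure {q}`, that is `q ⤳ p`; so `closure {p}` is
the set of `q ≤ p`, and the smallest open set `U_p` containing `p` is the set of `q ≥ p`. -/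

/-- `p` is a down beat point: `closure {p} \ {p}` has a maximum `q`. -/
def IsDownBeatPoint (X : RingedSpace.{u, u}) (p : X.carrier) : Prop :=
  ∃ q : X.carrier, q ≠ p ∧ p ⤳ q ∧ ∀ q' : X.carrier, q' ≠ p → p ⤳ q' → q ⤳ q'

/-- `p` is an up beat point: `U_p \ {p}` has a minimum `q` and the restriction morphism
`r_{pq} : 𝒪_p ⟶ 𝒪_q` is an isomorphism. -/
def IsUpBeatPoint (X : RingedSpace.{u, u}) (p : X.carrier) : Prop :=
  ∃ (q : X.carrier) (h : q ⤳ p), q ≠ p ∧ (∀ q' : X.carrier, q' ≠ p → q' ⤳ p → q' ⤳ q) ∧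
    IsIso (X.presheaf.stalkSpecializes h)

/-- `X` is a minimal ringed finite space: a finite `T₀` ringed space without beat points. -/
structure IsMinimal (X : RingedSpace.{u, u}) : Prop where
  finite : Finite X.carrier
  t0 : T0Space X.carrier
  not_down : ∀ p : X.carrier, ¬ IsDownBeatPoint X p
  not_up : ∀ p : X.carrier, ¬ IsUpBeatPoint X p

/-- `S` is a core of `X`: a strong deformation retract that is a minimal ringed finite space. -/
def IsCore (X : RingedSpace.{u, u}) (S : Set X.carrier) : Prop :=
  IsStrongDeformationRetract X S ∧ IsMinimal (subspace X S)

end RingedFinite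

end

/-! Morphisms into a ringed space are preordered: `f` lies below `g` (`Coarsens f g`) when each `f
x` is a specialization of `g x` and the sheaf map of `f` is that of `g` followed by restriction.
Comparable morphisms are homotopic: the family equal to `f` at time 0 and to `g` afterwards is a
homotopy (`Coarsens.homotopicThrough`). Conversely, for finite spaces any homotopy satisfies `H_{t₀}
≤ H_t` for `t` near `t₀` (`eventually_coarsens`): on points by finiteness, on sections because germs
of the inverse image sheaf are locally constant in `t`.

Rigidity: an endomorphism of a minimal space comparable with the identity is the identity, since an
extremal point that it moves would be a beat point. So the times at which a homotopy on a minimal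
space equals the identity form a clopen subset of `[0,1]`, and only the identity is homotopic to the
identity (`IsMinimal.eq_id_of_homotopic`). Homotopy equivalences of minimal spaces are therefore
isomorphisms.

Existence: the endomorphism moving a beat point `p` to its neighbour `q` is comparable with the
identity, so the complement of `p` is a strong deformation retract; for an up beat point the
isomorphism `r_{pq}` supplies the sheaf map. A strong deformation retract with the fewest points is
then a core. Cores being homotopy equivalent to their ambient spaces, rigidity and the transitivity
of homotopy give uniqueness and the classification. -/

noncomputable section

namespace RingedFinite

/-! ## Sections and their restrictions -/

section Sections

variable {W X Y Z : RingedSpace.{u, u}}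

/-- The preimage of an open set under a morphism of ringed spaces. -/
def pre (f : W ⟶ X) (V : Opens X.carrier) : Opens W.carrier :=
  (Opens.map f.hom.base).obj V

/-- The ring of sections over an open set. -/
abbrev sec (X : RingedSpace.{u, u}) (U : Opens X.carrier) : CommRingCat.{u} :=
  X.presheaf.obj (op U)

/-- The restriction of sections. -/
def res (X : RingedSpace.{u, u}) {U V : Opens X.carrier} (h : U ≤ V) : sec X V ⟶ sec X U :=
  X.presheaf.map (homOfLE h).op

lemma res_refl (U : Opens X.carrier) (h : U ≤ U) : res X h = 𝟙 _ :=
  X.presheaf.map_id _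

lemma res_res {U V T : Opens X.carrier} (h : U ≤ V) (h' : V ≤ T) :
    res X h' ≫ res X h = res X (h.trans h') :=
  (X.presheaf.map_comp _ _).symm

/-- The map on sections `𝒪_Y(V) ⟶ 𝒪_X(f⁻¹ V)` of a morphism `f : X ⟶ Y`. -/
def appTop (f : X ⟶ Y) (V : Opens Y.carrier) : sec Y V ⟶ sec X (pre f V) :=
  f.hom.c.app (op V)

/-- The map on sections `𝒪_Y(V) ⟶ 𝒪_X(U)` of a morphism `f : X ⟶ Y`, for `U ⊆ f⁻¹ V`. -/
def appLE (f : X ⟶ Y) (V : Opens Y.carrier) (U : Opens X.carrier) (h : U ≤ pre f V) :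
    sec Y V ⟶ sec X U :=
  appTop f V ≫ res X h

lemma pre_mono (f : X ⟶ Y) {V V' : Opens Y.carrier} (h : V ≤ V') : pre f V ≤ pre f V' :=
  fun _ hx => h hx

lemma le_pre_comp (f : X ⟶ Y) (g : Y ⟶ Z) {V : Opens Z.carrier} {U : Opens Y.carrier}
    {T : Opens X.carrier} (h : U ≤ pre g V) (h' : T ≤ pre f U) : T ≤ pre (f ≫ g) V :=
  fun _ hx => h (h' hx)

lemma le_pre_id {U V : Opens X.carrier} (h : U ≤ V) : U ≤ pre (𝟙 X) V := h

lemma appLE_res (f : X ⟶ Y) {V : Opens Y.carrier} {U U' : Opens X.carrier} (h : U ≤ pre f V)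
    (h' : U' ≤ U) : appLE f V U h ≫ res X h' = appLE f V U' (h'.trans h) := by
  rw [appLE, Category.assoc, res_res, appLE]

lemma res_appTop (f : X ⟶ Y) {V V' : Opens Y.carrier} (h' : V ≤ V') :
    res Y h' ≫ appTop f V = appTop f V' ≫ res X (pre_mono f h') :=
  f.hom.c.naturality (homOfLE h').op

lemma res_appLE (f : X ⟶ Y) {V V' : Opens Y.carrier} {U : Opens X.carrier} (h : U ≤ pre f V)
    (h' : V ≤ V') :
    res Y h' ≫ appLE f V U h = appLE f V' U (h.trans (pre_mono f h')) := by
  rw [appLE, ← Category.assoc, res_appTop, Category.assoc, res_res, appLE]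

lemma appLE_comp (f : X ⟶ Y) (g : Y ⟶ Z) {V : Opens Z.carrier} {U : Opens Y.carrier}
    {T : Opens X.carrier} (h : U ≤ pre g V) (h' : T ≤ pre f U) :
    appLE g V U h ≫ appLE f U T h' = appLE (f ≫ g) V T (le_pre_comp f g h h') := by
  rw [appLE, Category.assoc, res_appLE, appLE, appLE, ← Category.assoc]
  rfl

lemma appLE_id {V U : Opens X.carrier} (h : U ≤ V) : appLE (𝟙 X) V U (le_pre_id h) = res X h :=
  Category.id_comp _

lemma appLE_congr {f g : X ⟶ Y} (e : f = g) {V : Opens Y.carrier} {U : Opens X.carrier}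
    (h : U ≤ pre f V) : appLE f V U h = appLE g V U (e ▸ h) := by
  subst e; rfl

/-- Morphisms of ringed spaces are equal if their maps on points and on sections are. -/
lemma hom_ext_appLE {f g : X ⟶ Y} (hb : ∀ x, f.hom.base x = g.hom.base x)
    (hc : ∀ (V : Opens Y.carrier) (hf : pre f V ≤ pre f V) (hg : pre f V ≤ pre g V),
      appLE f V (pre f V) hf = appLE g V (pre f V) hg) : f = g := by
  obtain ⟨⟨b, c⟩⟩ := f
  obtain ⟨⟨b', c'⟩⟩ := g
  obtain rfl : b = b' := TopCat.hom_ext (ContinuousMap.ext hb)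
  have : c = c' := by
    refine NatTrans.ext (funext fun V => ?_)
    have key : ∀ d : sec Y V.unop ⟶ sec X ((Opens.map b).obj V.unop),
        d ≫ res X (le_refl ((Opens.map b).obj V.unop)) = d := fun d =>
      (congrArg (d ≫ ·) (res_refl _ _)).trans (Category.comp_id _)
    exact (key _).symm.trans ((hc V.unop le_rfl le_rfl).trans (key _))
  subst this
  rfl

/-- A morphism of ringed spaces given by a continuous map and compatible maps on sections. -/
def mkHom (b : C(X.carrier, Y.carrier))
    (φ : ∀ V : Opens Y.carrier, sec Y V ⟶ sec X (V.comap b))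
    (hφ : ∀ (V V' : Opens Y.carrier) (h : V ≤ V'),
      res Y h ≫ φ V = φ V' ≫ res X (Opens.comap_mono b h)) : X ⟶ Y :=
  InducedCategory.homMk
    { base := TopCat.ofHom b
      c :=
        { app := fun V => φ V.unop
          naturality := fun V V' i => hφ V'.unop V.unop (leOfHom i.unop) } }

lemma mkHom_appLE (b : C(X.carrier, Y.carrier)) (φ hφ) (V : Opens Y.carrier) (U : Opens X.carrier)
    (h : U ≤ pre (mkHom (Y := Y) b φ hφ) V) :
    appLE (mkHom b φ hφ) V U h = φ V ≫ res X (V := V.comap b) h := rfl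

end Sections

/-! ## The order on morphisms -/

section Coarsening

variable {W X Y Z : RingedSpace.{u, u}}

/-- `Coarsens f g` for `f, g : X ⟶ Y`: each `f x` is a specialization of `g x`, and the map on
sections of `f` is the one of `g` followed by restriction. -/
structure Coarsens (f g : X ⟶ Y) : Prop where
  pre_le : ∀ V : Opens Y.carrier, pre f V ≤ pre g V
  appLE_eq : ∀ (V : Opens Y.carrier) (U : Opens X.carrier) (h : U ≤ pre f V),
    appLE f V U h = appLE g V U (h.trans (pre_le V))

lemma Coarsens.refl (f : X ⟶ Y) : Coarsens f f := ⟨fun _ => le_rfl, fun _ _ _ => rfl⟩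

lemma Coarsens.specializes {f g : X ⟶ Y} (h : Coarsens f g) (x : X.carrier) :
    g.hom.base x ⤳ f.hom.base x :=
  specializes_iff_forall_open.2 fun V hV hx => h.pre_le ⟨V, hV⟩ hx

lemma Coarsens.comp_left (k : W ⟶ X) {f g : X ⟶ Y} (h : Coarsens f g) :
    Coarsens (k ≫ f) (k ≫ g) := by
  refine ⟨fun V x hx => h.pre_le V hx, fun V U hU => ?_⟩
  replace hU : U ≤ pre k (pre f V) := hU
  rw [← appLE_comp k f (le_refl (pre f V)) hU, h.appLE_eq, appLE_comp]

lemma Coarsens.comp_right {f g : X ⟶ Y} (h : Coarsens f g) (k : Y ⟶ Z) :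
    Coarsens (f ≫ k) (g ≫ k) := by
  refine ⟨fun V x hx => h.pre_le (pre k V) hx, fun V U hU => ?_⟩
  replace hU : U ≤ pre f (pre k V) := hU
  rw [← appLE_comp f k (le_refl (pre k V)) hU, h.appLE_eq, appLE_comp]

/-- A coarsening of `g` is determined by its underlying map. -/
lemma Coarsens.unique {f f' g : X ⟶ Y} (h : Coarsens f g) (h' : Coarsens f' g)
    (hb : ∀ x, f.hom.base x = f'.hom.base x) : f = f' :=
  hom_ext_appLE hb fun V hf hg => (h.appLE_eq V _ hf).trans (h'.appLE_eq V _ hg).symm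

lemma Coarsens.eq_of_base {f g : X ⟶ Y} (h : Coarsens f g)
    (hb : ∀ x, f.hom.base x = g.hom.base x) : f = g :=
  h.unique (Coarsens.refl g) hb

/-- The coarsening of `g` with a given underlying map. -/
lemma exists_coarsens (g : X ⟶ Y) (b : C(X.carrier, Y.carrier))
    (hb : ∀ x, g.hom.base x ⤳ b x) :
    ∃ f : X ⟶ Y, Coarsens f g ∧ ∀ x, f.hom.base x = b x := by
  have hle : ∀ V : Opens Y.carrier, V.comap b ≤ pre g V := fun V x hx =>
    (hb x).mem_open V.isOpen hx
  refine ⟨mkHom b (fun V => appLE g V _ (hle V)) fun V V' h => ?_, ⟨fun V => hle V, ?_⟩,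
    fun _ => rfl⟩
  · rw [res_appLE, appLE_res]
  · intro V U hU
    rw [mkHom_appLE]
    exact appLE_res g (hle V) hU

end Coarsening

/-! ## The cylinder -/

section Cylinder

variable {W X Y Z : RingedSpace.{u, u}}

/-- The projection `X × I ⟶ X`. -/
def cylinderProj (X : RingedSpace.{u, u}) : cylinder X ⟶ X := inverseImageHom X (cylinderFst X)

/-- The point `(x, t)` of the cylinder. -/
def cylinderPt (x : X.carrier) (t : unitInterval) : (cylinder X).carrier := (x, t)

/-- The time coordinate on the cylinder. -/
def cylinderTime (X : RingedSpace.{u, u}) : C((cylinder X).carrier, unitInterval) :=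
  ⟨fun p => Prod.snd (p : X.carrier × unitInterval), continuous_snd⟩

lemma continuous_cylinderPt {T : Type*} [TopologicalSpace T] {f : T → X.carrier}
    {τ : T → unitInterval} (hf : Continuous f) (hτ : Continuous τ) :
    Continuous fun w => cylinderPt (f w) (τ w) :=
  hf.prodMk hτ

lemma cylinder_ext {p q : (cylinder X).carrier}
    (h : (cylinderProj X).hom.base p = (cylinderProj X).hom.base q)
    (h' : cylinderTime X p = cylinderTime X q) : p = q :=
  Prod.ext h h'

lemma cylinderAt_proj (t : unitInterval) : cylinderAt X t ≫ cylinderProj X = 𝟙 X :=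
  inverseImageLift_comp _ _ _ _

/-- A morphism to the cylinder is determined by its two components. -/
lemma cylinder_hom_ext {a b : W ⟶ cylinder X} (h : a ≫ cylinderProj X = b ≫ cylinderProj X)
    (h' : ∀ w, cylinderTime X (a.hom.base w) = cylinderTime X (b.hom.base w)) : a = b := by
  refine inverseImage_hom_ext _ a b (TopCat.hom_ext (ContinuousMap.ext fun w => ?_)) h
  exact cylinder_ext (congrArg (fun k : W ⟶ X => k.hom.base w) h) (h' w)

/-- The morphism to the cylinder with given components. -/
lemma exists_cylinder_lift (φ : W ⟶ X) (τ : C(W.carrier, unitInterval)) :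
    ∃ a : W ⟶ cylinder X, a ≫ cylinderProj X = φ ∧
      ∀ w, cylinderTime X (a.hom.base w) = τ w :=
  ⟨inverseImageLift (cylinderFst X) φ
    (TopCat.ofHom ⟨fun w => (φ.hom.base w, τ w), by fun_prop⟩) rfl,
    inverseImageLift_comp _ _ _ _, fun _ => rfl⟩

/-- The reparametrization `X × I ⟶ X × I`, `(x, t) ↦ (x, α t)`. -/
lemma exists_reparam (X : RingedSpace.{u, u}) (α : C(unitInterval, unitInterval)) :
    ∃ a : cylinder X ⟶ cylinder X, a ≫ cylinderProj X = cylinderProj X ∧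
      (∀ w, cylinderTime X (a.hom.base w) = α (cylinderTime X w)) ∧
      ∀ t, cylinderAt X t ≫ a = cylinderAt X (α t) := by
  obtain ⟨a, h, h'⟩ := exists_cylinder_lift (cylinderProj X) (α.comp (cylinderTime X))
  refine ⟨a, h, h', fun t => cylinder_hom_ext ?_ fun w => h' _⟩
  rw [Category.assoc, h, cylinderAt_proj, cylinderAt_proj]

/-- The functoriality of the cylinder. -/
lemma exists_cylinderMap (k : W ⟶ X) :
    ∃ a : cylinder W ⟶ cylinder X, ∀ t, cylinderAt W t ≫ a = k ≫ cylinderAt X t := by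
  obtain ⟨a, h, h'⟩ := exists_cylinder_lift (cylinderProj W ≫ k) (cylinderTime W)
  refine ⟨a, fun t => cylinder_hom_ext ?_ fun w => h' _⟩
  rw [Category.assoc, h, ← Category.assoc, cylinderAt_proj, Category.assoc, cylinderAt_proj,
    Category.id_comp, Category.comp_id]

end Cylinder

/-! ## Homotopies through morphisms with a given property -/

section Homotopy

variable {W X Y Z : RingedSpace.{u, u}}

/-- There is a homotopy `H` from `f` to `g` such that every `H_t` satisfies `P`. -/
def HomotopicThrough (P : (X ⟶ Y) → Prop) (f g : X ⟶ Y) : Prop :=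
  ∃ H : cylinder X ⟶ Y, cylinderAt X 0 ≫ H = f ∧ cylinderAt X 1 ≫ H = g ∧
    ∀ t : unitInterval, P (cylinderAt X t ≫ H)

lemma HomotopicThrough.homotopic {P : (X ⟶ Y) → Prop} {f g : X ⟶ Y}
    (h : HomotopicThrough P f g) : Homotopic f g :=
  let ⟨H, h0, h1, _⟩ := h; ⟨H, h0, h1⟩

lemma Homotopic.through {f g : X ⟶ Y} (h : Homotopic f g) :
    HomotopicThrough (fun _ => True) f g :=
  let ⟨H, h0, h1⟩ := h; ⟨H, h0, h1, fun _ => trivial⟩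

lemma HomotopicThrough.mono {P Q : (X ⟶ Y) → Prop} {f g : X ⟶ Y}
    (h : HomotopicThrough P f g) (hPQ : ∀ k, P k → Q k) : HomotopicThrough Q f g :=
  let ⟨H, h0, h1, hP⟩ := h; ⟨H, h0, h1, fun t => hPQ _ (hP t)⟩

lemma HomotopicThrough.symm {P : (X ⟶ Y) → Prop} {f g : X ⟶ Y}
    (h : HomotopicThrough P f g) : HomotopicThrough P g f := by
  obtain ⟨H, h0, h1, hP⟩ := h
  obtain ⟨a, -, -, ha⟩ := exists_reparam X ⟨unitInterval.symm, unitInterval.continuous_symm⟩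
  refine ⟨a ≫ H, ?_, ?_, fun t => ?_⟩
  · rw [← Category.assoc, ha, ← h1]
    exact congrArg (fun s => cylinderAt X s ≫ H) unitInterval.symm_zero
  · rw [← Category.assoc, ha, ← h0]
    exact congrArg (fun s => cylinderAt X s ≫ H) unitInterval.symm_one
  · rw [← Category.assoc, ha]
    exact hP _

lemma HomotopicThrough.comp_left {P : (X ⟶ Y) → Prop} {f g : X ⟶ Y}
    (h : HomotopicThrough P f g) (k : W ⟶ X) :
    HomotopicThrough (fun l => ∃ m, P m ∧ l = k ≫ m) (k ≫ f) (k ≫ g) := by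
  obtain ⟨H, h0, h1, hP⟩ := h
  obtain ⟨a, ha⟩ := exists_cylinderMap k
  refine ⟨a ≫ H, ?_, ?_, fun t => ⟨_, hP t, ?_⟩⟩
  all_goals rw [← Category.assoc, ha, Category.assoc]
  · rw [h0]
  · rw [h1]

lemma HomotopicThrough.comp_right {P : (X ⟶ Y) → Prop} {f g : X ⟶ Y}
    (h : HomotopicThrough P f g) (k : Y ⟶ Z) :
    HomotopicThrough (fun l => ∃ m, P m ∧ l = m ≫ k) (f ≫ k) (g ≫ k) := by
  obtain ⟨H, h0, h1, hP⟩ := h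
  refine ⟨H ≫ k, ?_, ?_, fun t => ⟨_, hP t, ?_⟩⟩
  · rw [← Category.assoc, h0]
  · rw [← Category.assoc, h1]
  · rw [Category.assoc]

lemma HomotopicThrough.refl {P : (X ⟶ Y) → Prop} {f : X ⟶ Y} (h : P f) :
    HomotopicThrough P f f := by
  have e : ∀ t, cylinderAt X t ≫ cylinderProj X ≫ f = f := fun t => by
    rw [← Category.assoc, cylinderAt_proj, Category.id_comp]
  exact ⟨cylinderProj X ≫ f, e 0, e 1, fun t => (e t).symm ▸ h⟩

/-- A coarsening `f` of `g` is homotopic to `g` through `f` and `g`. -/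
lemma Coarsens.homotopicThrough {f g : X ⟶ Y} (h : Coarsens f g) :
    HomotopicThrough (fun k => k = f ∨ k = g) f g := by
  classical
  let b : (cylinder X).carrier → Y.carrier := fun p =>
    if cylinderTime X p = 0 then f.hom.base ((cylinderProj X).hom.base p)
    else g.hom.base ((cylinderProj X).hom.base p)
  have hb : Continuous b := by
    refine continuous_def.2 fun V hV => ?_
    -- The inclusion of `pre f V` in `pre g V` makes this union of open sets correct also at times
    -- other than 0.
    have e : b ⁻¹' V = (pre (cylinderProj X) (pre f ⟨V, hV⟩) : Set (cylinder X).carrier) ∪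
        ((pre (cylinderProj X) (pre g ⟨V, hV⟩) : Set (cylinder X).carrier) ∩
          cylinderTime X ⁻¹' {0}ᶜ) := by
      ext p
      change b p ∈ V ↔ f.hom.base ((cylinderProj X).hom.base p) ∈ V ∨
        (g.hom.base ((cylinderProj X).hom.base p) ∈ V ∧ ¬ cylinderTime X p = 0)
      have : f.hom.base ((cylinderProj X).hom.base p) ∈ V →
        g.hom.base ((cylinderProj X).hom.base p) ∈ V := fun hx => h.pre_le ⟨V, hV⟩ hx
      by_cases h0 : cylinderTime X p = 0
      · simp only [b, if_pos h0]; tauto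
      · simp only [b, if_neg h0]; tauto
    rw [e]
    exact (Opens.isOpen _).union ((Opens.isOpen _).inter
      (isOpen_compl_singleton.preimage (cylinderTime X).continuous))
  -- The sheaf map comes for free: `b` lies below the constant homotopy at `g`. Each `H_t` is then a
  -- coarsening of `g`, hence determined by its points.
  obtain ⟨H, hH, hHb⟩ := exists_coarsens (cylinderProj X ≫ g) ⟨b, hb⟩ fun p => by
    change g.hom.base ((cylinderProj X).hom.base p) ⤳ b p
    by_cases h0 : cylinderTime X p = 0
    · simp only [b, if_pos h0]; exact h.specializes _
    · simp only [b, if_neg h0]; exact specializes_rfl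
  have hle : ∀ t, Coarsens (cylinderAt X t ≫ H) g := fun t => by
    have := hH.comp_left (cylinderAt X t)
    rwa [← Category.assoc, cylinderAt_proj, Category.id_comp] at this
  have H0 : cylinderAt X 0 ≫ H = f := (hle 0).unique h fun x => (hHb _).trans (if_pos rfl)
  have Ht : ∀ t, t ≠ 0 → cylinderAt X t ≫ H = g := fun t ht =>
    (hle t).eq_of_base fun x => (hHb _).trans (if_neg ht)
  refine ⟨H, H0, Ht 1 one_ne_zero, fun t => ?_⟩
  by_cases h0 : t = 0
  · subst h0; exact Or.inl H0
  · exact Or.inr (Ht t h0)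

end Homotopy

/-! ## Gluing of morphisms -/

section Gluing

variable {W X Y Z : RingedSpace.{u, u}}

lemma exists_glue_sections {A B D : Opens X.carrier} (hA : A ≤ D) (hB : B ≤ D) (hD : D ≤ A ⊔ B)
    {R : CommRingCat.{u}} (a : R ⟶ sec X A) (b : R ⟶ sec X B)
    (hab : a ≫ res X (inf_le_left : A ⊓ B ≤ A) = b ≫ res X (inf_le_right : A ⊓ B ≤ B)) :
    ∃ c : R ⟶ sec X D, c ≫ res X hA = a ∧ c ≫ res X hB = b := by
  obtain rfl : D = A ⊔ B := le_antisymm hD (sup_le hA hB)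
  let s : Limits.PullbackCone (X.sheaf.1.map (homOfLE inf_le_left : A ⊓ B ⟶ _).op)
    (X.sheaf.1.map (homOfLE inf_le_right).op) := Limits.PullbackCone.mk a b hab
  exact ⟨X.sheaf.interUnionPullbackConeLift A B s, X.sheaf.interUnionPullbackConeLift_left A B s,
    X.sheaf.interUnionPullbackConeLift_right A B s⟩

lemma sections_hom_ext {A B D : Opens X.carrier} (hA : A ≤ D) (hB : B ≤ D) (hD : D ≤ A ⊔ B)
    {R : CommRingCat.{u}} {c d : R ⟶ sec X D} (h : c ≫ res X hA = d ≫ res X hA)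
    (h' : c ≫ res X hB = d ≫ res X hB) : c = d := by
  obtain rfl : D = A ⊔ B := le_antisymm hD (sup_le hA hB)
  exact Limits.PullbackCone.IsLimit.hom_ext (X.sheaf.isLimitPullbackCone A B) h h'

/-- Two morphisms agree on an open set: on its points and on sections over its open subsets. -/
structure AgreeOn (a b : W ⟶ Y) (O : Opens W.carrier) : Prop where
  base_eq : ∀ w ∈ O, a.hom.base w = b.hom.base w
  appLE_eq : ∀ (V : Opens Y.carrier) (U : Opens W.carrier) (ha : U ≤ pre a V) (hb : U ≤ pre b V),
    U ≤ O → appLE a V U ha = appLE b V U hb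

lemma AgreeOn.comp_eq {a b : W ⟶ Y} {O : Opens W.carrier} (h : AgreeOn a b O) (k : Z ⟶ W)
    (hk : ∀ z, k.hom.base z ∈ O) : k ≫ a = k ≫ b := by
  refine hom_ext_appLE (fun z => h.base_eq _ (hk z)) fun V ha hb => ?_
  -- Sections are compared over `pre a V ⊓ O`, where agreement applies; nothing is lost because `k`
  -- lands in `O`.
  have h1 : pre a V ⊓ O ≤ pre a V := inf_le_left
  have h2 : pre a V ⊓ O ≤ pre b V := fun w hw => by
    have : a.hom.base w ∈ V := hw.1
    rwa [h.base_eq w hw.2] at this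
  have h3 : pre (k ≫ a) V ≤ pre k (pre a V ⊓ O) := fun z hz => ⟨hz, hk z⟩
  have ea := appLE_comp k a h1 h3
  have eb := appLE_comp k b h2 h3
  rw [h.appLE_eq V _ h1 h2 inf_le_right] at ea
  exact ea.symm.trans eb

/-- The inclusion of an open subspace. -/
def openIncl (W : RingedSpace.{u, u}) (O : Opens W.carrier) :
    W.restrict (Opens.isOpenEmbedding O) ⟶ W :=
  W.ofRestrict _

lemma openIncl_base (O : Opens W.carrier)
    (w : (W.restrict (Opens.isOpenEmbedding O) : RingedSpace.{u, u}).carrier) :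
    (openIncl W O).hom.base w ∈ O :=
  Subtype.property (p := fun x => x ∈ O) w

/-- Passing to the open subspace `O` loses no section over `U ⊆ O`; the left inverse allows
cancellation in the next lemma. -/
lemma openIncl_appTop_comp {O U : Opens W.carrier} (h : U ≤ O) :
    ∃ r : sec (W.restrict (Opens.isOpenEmbedding O) : RingedSpace.{u, u}) (pre (openIncl W O) U) ⟶
      sec W U, appTop (openIncl W O) U ≫ r = 𝟙 _ := by
  have hU : U ≤ (Opens.isOpenEmbedding O).isOpenMap.functor.obj (pre (openIncl W O) U) :=
    fun w hw => ⟨⟨w, h hw⟩, hw, rfl⟩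
  refine ⟨W.presheaf.map (homOfLE hU).op, ?_⟩
  refine (W.presheaf.map_comp _ _).symm.trans ?_
  exact W.presheaf.map_id _

/-- Reduces agreement on an open set to an equality of morphisms of ringed spaces, which for the
cylinder follows from its universal property. -/
lemma agreeOn_of_openIncl_comp {a b : W ⟶ Y} {O : Opens W.carrier}
    (h : openIncl W O ≫ a = openIncl W O ≫ b) : AgreeOn a b O := by
  refine ⟨fun w hw => congrArg (fun k => k.hom.base ⟨w, hw⟩) h, fun V U ha hb hU => ?_⟩
  obtain ⟨r, hr⟩ := openIncl_appTop_comp hU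
  have hr' : appLE (openIncl W O) U _ le_rfl ≫ r = 𝟙 _ := by
    rw [appLE, res_refl, Category.comp_id, hr]
  have e : appLE a V U ha ≫ appLE (openIncl W O) U _ le_rfl =
      appLE b V U hb ≫ appLE (openIncl W O) U _ le_rfl := by
    rw [appLE_comp, appLE_comp, appLE_congr h]
  have := congrArg (· ≫ r) e
  simpa only [Category.assoc, hr', Category.comp_id] using this

/-- Two morphisms which agree on the intersection of two open sets covering the space can be
glued. -/
lemma AgreeOn.exists_glue {a b : W ⟶ Y} {A B : Opens W.carrier} (hAB : ∀ w, w ∈ A ∨ w ∈ B)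
    (h : AgreeOn a b (A ⊓ B)) : ∃ m : W ⟶ Y, AgreeOn m a A ∧ AgreeOn m b B := by
  classical
  let m : W.carrier → Y.carrier := fun w => if w ∈ A then a.hom.base w else b.hom.base w
  have mA : ∀ w ∈ A, m w = a.hom.base w := fun w hw => if_pos hw
  have mB : ∀ w ∈ B, m w = b.hom.base w := fun w hw => by
    by_cases hA : w ∈ A
    · rw [mA w hA, h.base_eq w ⟨hA, hw⟩]
    · exact if_neg hA
  have hm : Continuous m := by
    refine continuous_def.2 fun V hV => ?_
    have e : m ⁻¹' V =
        ((pre a ⟨V, hV⟩ ⊓ A) ⊔ (pre b ⟨V, hV⟩ ⊓ B) : Opens W.carrier) := by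
      ext w
      change m w ∈ V ↔ (a.hom.base w ∈ V ∧ w ∈ A) ∨ (b.hom.base w ∈ V ∧ w ∈ B)
      constructor
      · intro hw
        rcases hAB w with hA | hB
        · exact Or.inl ⟨mA w hA ▸ hw, hA⟩
        · exact Or.inr ⟨mB w hB ▸ hw, hB⟩
      · rintro (⟨hw, hA⟩ | ⟨hw, hB⟩)
        · rwa [mA w hA]
        · rwa [mB w hB]
    rw [e]
    exact Opens.isOpen _
  let P : Opens Y.carrier → Opens W.carrier := fun V => V.comap ⟨m, hm⟩
  have hP : ∀ {V V'}, V ≤ V' → P V ≤ P V' := fun h w hw => h hw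
  have PA : ∀ V, P V ⊓ A ≤ pre a V := fun V w hw => by
    have : m w ∈ V := hw.1
    rwa [mA w hw.2] at this
  have PB : ∀ V, P V ⊓ B ≤ pre b V := fun V w hw => by
    have : m w ∈ V := hw.1
    rwa [mB w hw.2] at this
  have cov : ∀ V, P V ≤ (P V ⊓ A) ⊔ (P V ⊓ B) := fun V w hw =>
    (hAB w).imp (fun hA => ⟨hw, hA⟩) (fun hB => ⟨hw, hB⟩)
  have key : ∀ V, ∃ c : sec Y V ⟶ sec W (P V),
      c ≫ res W (inf_le_left : P V ⊓ A ≤ _) = appLE a V (P V ⊓ A) (PA V) ∧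
      c ≫ res W (inf_le_left : P V ⊓ B ≤ _) = appLE b V (P V ⊓ B) (PB V) := fun V =>
    exists_glue_sections _ _ (cov V) _ _ (by
      rw [appLE_res, appLE_res]
      exact h.appLE_eq V _ _ _ fun w hw => ⟨hw.1.2, hw.2.2⟩)
  choose φ φA φB using key
  let M : W ⟶ Y := mkHom ⟨m, hm⟩ φ fun V V' hVV => by
    change res Y hVV ≫ φ V = φ V' ≫ res W (hP hVV)
    refine sections_hom_ext inf_le_left inf_le_left (cov V) ?_ ?_
    · rw [Category.assoc, φA, Category.assoc, res_res, res_appLE,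
        ← res_res (inf_le_inf_right A (hP hVV)) inf_le_left, ← Category.assoc, φA, appLE_res]
    · rw [Category.assoc, φB, Category.assoc, res_res, res_appLE,
        ← res_res (inf_le_inf_right B (hP hVV)) inf_le_left, ← Category.assoc, φB, appLE_res]
  refine ⟨M, ⟨mA, fun V U hM ha hU => ?_⟩, ⟨mB, fun V U hM hb hU => ?_⟩⟩
  · replace hM : U ≤ P V := hM
    rw [mkHom_appLE]
    change φ V ≫ res W hM = _
    rw [← res_res (le_inf hM hU) inf_le_left, ← Category.assoc, φA, appLE_res]
  · replace hM : U ≤ P V := hM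
    rw [mkHom_appLE]
    change φ V ≫ res W hM = _
    rw [← res_res (le_inf hM hU) inf_le_left, ← Category.assoc, φB, appLE_res]

end Gluing

/-! ## Transitivity of homotopy -/

section Transitivity

variable {W X Y Z : RingedSpace.{u, u}}

/-- A reparametrization that takes the constant value `s` on the times in an open set of the
cylinder agrees there with the projection to time `s`. -/
lemma agreeOn_reparam {a : cylinder X ⟶ cylinder X} {α : C(unitInterval, unitInterval)}
    (h : a ≫ cylinderProj X = cylinderProj X)
    (h' : ∀ w, cylinderTime X (a.hom.base w) = α (cylinderTime X w)) (s : unitInterval)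
    {O : Opens (cylinder X).carrier} (hO : ∀ w ∈ O, α (cylinderTime X w) = s) :
    openIncl _ O ≫ a = openIncl _ O ≫ cylinderProj X ≫ cylinderAt X s := by
  refine cylinder_hom_ext ?_ fun w => ?_
  · rw [Category.assoc, h, Category.assoc, Category.assoc, cylinderAt_proj, Category.comp_id]
  · exact (h' _).trans (hO _ (openIncl_base O w))

/-- Gluing sheaf maps calls for an open cover, so the two homotopies are made to overlap. Clamping
`3t` and `3t - 2` to `[0,1]` makes the first rest at `g` from time 1/3 on and the second rest at `g`
until time 2/3; they agree on the open overlap. -/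
lemma HomotopicThrough.trans {P : (X ⟶ Y) → Prop} {f g k : X ⟶ Y}
    (h₁ : HomotopicThrough P f g) (h₂ : HomotopicThrough P g k) : HomotopicThrough P f k := by
  obtain ⟨H, H0, H1, HP⟩ := h₁
  obtain ⟨K, K0, K1, KP⟩ := h₂
  let α : C(unitInterval, unitInterval) :=
    ⟨fun t => Set.projIcc 0 1 zero_le_one (3 * (t : ℝ)),
      continuous_projIcc.comp (by fun_prop)⟩
  let β : C(unitInterval, unitInterval) :=
    ⟨fun t => Set.projIcc 0 1 zero_le_one (3 * (t : ℝ) - 2),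
      continuous_projIcc.comp (by fun_prop)⟩
  have α1 : ∀ t : unitInterval, (1 / 3 : ℝ) ≤ t → α t = 1 := fun t ht =>
    Set.projIcc_of_right_le zero_le_one (by linarith)
  have β0 : ∀ t : unitInterval, (t : ℝ) ≤ 2 / 3 → β t = 0 := fun t ht =>
    Set.projIcc_of_le_left zero_le_one (by linarith)
  have α0 : α 0 = 0 := Set.projIcc_of_le_left zero_le_one (by simp)
  have β1 : β 1 = 1 := Set.projIcc_of_right_le zero_le_one (by norm_num)
  obtain ⟨a, ha, ha', hat⟩ := exists_reparam X α
  obtain ⟨b, hb, hb', hbt⟩ := exists_reparam X β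
  let A : Opens (cylinder X).carrier := ⟨{w | (cylinderTime X w : ℝ) < 2 / 3},
    isOpen_lt (continuous_subtype_val.comp (cylinderTime X).continuous) continuous_const⟩
  let B : Opens (cylinder X).carrier := ⟨{w | (1 / 3 : ℝ) < cylinderTime X w},
    isOpen_lt continuous_const (continuous_subtype_val.comp (cylinderTime X).continuous)⟩
  have agree : AgreeOn (a ≫ H) (b ≫ K) (A ⊓ B) := by
    apply agreeOn_of_openIncl_comp
    have eA := agreeOn_reparam ha ha' 1 (O := A ⊓ B) fun w hw => α1 _ (le_of_lt hw.2)
    have eB := agreeOn_reparam hb hb' 0 (O := A ⊓ B) fun w hw => β0 _ (le_of_lt hw.1)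
    have eA' := congrArg (· ≫ H) eA
    have eB' := congrArg (· ≫ K) eB
    simp only [Category.assoc, H1] at eA'
    simp only [Category.assoc, K0] at eB'
    exact eA'.trans eB'.symm
  obtain ⟨M, MA, MB⟩ := agree.exists_glue fun w => by
    rcases lt_or_ge (cylinderTime X w : ℝ) (2 / 3) with h | h
    · exact Or.inl h
    · exact Or.inr (show (1 / 3 : ℝ) < cylinderTime X w by linarith)
  have tA : ∀ t : unitInterval, (t : ℝ) < 2 / 3 → cylinderAt X t ≫ M = cylinderAt X (α t) ≫ H :=
    fun t ht => by
      rw [MA.comp_eq (cylinderAt X t) fun _ => ht, ← Category.assoc, hat]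
  have tB : ∀ t : unitInterval, (1 / 3 : ℝ) < t → cylinderAt X t ≫ M = cylinderAt X (β t) ≫ K :=
    fun t ht => by
      rw [MB.comp_eq (cylinderAt X t) fun _ => ht, ← Category.assoc, hbt]
  refine ⟨M, ?_, ?_, fun t => ?_⟩
  · rw [tA 0 (by norm_num), α0, H0]
  · rw [tB 1 (by norm_num), β1, K1]
  · rcases lt_or_ge (t : ℝ) (2 / 3) with h | h
    · rw [tA t h]; exact HP _
    · rw [tB t (by linarith)]; exact KP _

end Transitivity

/-! ## Homotopy equivalences -/

section HomotopyEquivalence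

variable {X Y Z : RingedSpace.{u, u}}

lemma Homotopic.symm {f g : X ⟶ Y} (h : Homotopic f g) : Homotopic g f :=
  h.through.symm.homotopic

lemma Homotopic.trans {f g k : X ⟶ Y} (h : Homotopic f g) (h' : Homotopic g k) : Homotopic f k :=
  (h.through.trans h'.through).homotopic

lemma Homotopic.refl (f : X ⟶ Y) : Homotopic f f :=
  (HomotopicThrough.refl (P := fun _ => True) trivial).homotopic

lemma IsHomotopyEquiv.comp {f : X ⟶ Y} {g : Y ⟶ Z} (hf : IsHomotopyEquiv f)
    (hg : IsHomotopyEquiv g) : IsHomotopyEquiv (f ≫ g) := by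
  obtain ⟨f', hf1, hf2⟩ := hf
  obtain ⟨g', hg1, hg2⟩ := hg
  refine ⟨g' ≫ f', ?_, ?_⟩
  · have := ((hg1.through.comp_left f).comp_right f').homotopic
    rw [Category.comp_id, Category.assoc, Category.assoc] at this
    rw [Category.assoc]
    exact this.trans hf1
  · have := ((hf2.through.comp_left g').comp_right g).homotopic
    rw [Category.comp_id, Category.assoc, Category.assoc] at this
    rw [Category.assoc]
    exact this.trans hg2

lemma IsHomotopyEquiv.exists_inverse {f : X ⟶ Y} (hf : IsHomotopyEquiv f) :
    ∃ g : Y ⟶ X, IsHomotopyEquiv g :=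
  let ⟨g, h, h'⟩ := hf; ⟨g, f, h', h⟩

lemma isHomotopyEquiv_of_iso (e : X ≅ Y) : IsHomotopyEquiv e.hom :=
  ⟨e.inv, e.hom_inv_id ▸ Homotopic.refl _, e.inv_hom_id ▸ Homotopic.refl _⟩

end HomotopyEquivalence

/-! ## Strong deformation retracts -/

section Retracts

variable {W X Y : RingedSpace.{u, u}}

lemma IsStrongDeformationRetract.isHomotopyEquiv {S : Set X.carrier}
    (h : IsStrongDeformationRetract X S) : IsHomotopyEquiv (subspaceι X S) := by
  obtain ⟨r, hr, H, h0, h1, -⟩ := h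
  exact ⟨r, hr ▸ Homotopic.refl _, Homotopic.symm ⟨H, h0, h1⟩⟩

lemma subspaceι_base_mem (S : Set X.carrier) (s : (subspace X S).carrier) :
    (subspaceι X S).hom.base s ∈ S :=
  Subtype.property (p := fun x => x ∈ S) s

lemma subspace_hom_ext {S : Set X.carrier} {a b : W ⟶ subspace X S}
    (h : a ≫ subspaceι X S = b ≫ subspaceι X S) : a = b := by
  refine inverseImage_hom_ext _ a b (TopCat.hom_ext (ContinuousMap.ext fun w => ?_)) h
  exact Subtype.ext (congrArg (fun k : W ⟶ X => k.hom.base w) h)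

lemma exists_subspace_lift {S : Set X.carrier} (φ : W ⟶ X) (h : ∀ w, φ.hom.base w ∈ S) :
    ∃ a : W ⟶ subspace X S, a ≫ subspaceι X S = φ :=
  ⟨inverseImageLift _ φ (TopCat.ofHom ⟨fun w => ⟨φ.hom.base w, h w⟩, by fun_prop⟩) rfl,
    inverseImageLift_comp _ _ _ _⟩

/-- A subset `S` is a strong deformation retract if there is an endomorphism with values in `S`
homotopic to the identity through morphisms that restrict to the inclusion of `S`. -/
lemma isStrongDeformationRetract_of_homotopicThrough {S : Set X.carrier} {g : X ⟶ X}
    (hg : ∀ x, g.hom.base x ∈ S)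
    (h : HomotopicThrough (fun k => subspaceι X S ≫ k = subspaceι X S) (𝟙 X) g) :
    IsStrongDeformationRetract X S := by
  obtain ⟨r, hr⟩ := exists_subspace_lift g hg
  obtain ⟨H, h0, h1, hH⟩ := h
  refine ⟨r, subspace_hom_ext ?_, H, h0, h1.trans hr.symm, fun t => ?_⟩
  · rw [Category.assoc, hr, Category.id_comp, ← h1]
    exact hH 1
  · rw [Category.comp_id]
    exact hH t

lemma isStrongDeformationRetract_univ : IsStrongDeformationRetract X Set.univ :=
  isStrongDeformationRetract_of_homotopicThrough (g := 𝟙 X) (fun _ => trivial)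
    (HomotopicThrough.refl (Category.comp_id _))

/-- The homotopy onto `S` is followed by the one inside `S`, precomposed with `r` and pushed into
`X`. Both are stationary on the image of `T`, because its inclusion factors through `S` and then
through `T`. -/
lemma IsStrongDeformationRetract.trans {S : Set X.carrier}
    (h : IsStrongDeformationRetract X S) {T : Set (subspace X S).carrier}
    (h' : IsStrongDeformationRetract (subspace X S) T) :
    IsStrongDeformationRetract X ((subspaceι X S).hom.base '' T) := by
  obtain ⟨r, hr, H, h0, h1, hH⟩ := h
  obtain ⟨q, hq, K, k0, k1, hK⟩ := h'
  set U := (subspaceι X S).hom.base '' T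
  obtain ⟨l, hl⟩ := exists_subspace_lift (S := S) (subspaceι X U) fun w => by
    obtain ⟨s, -, hs⟩ := subspaceι_base_mem U w
    exact hs ▸ subspaceι_base_mem S s
  obtain ⟨m, hm⟩ := exists_subspace_lift (S := T) l fun w => by
    obtain ⟨s, hsT, hs⟩ := subspaceι_base_mem U w
    have : (subspaceι X S).hom.base (l.hom.base w) = (subspaceι X S).hom.base s :=
      (congrArg (fun k : subspace X U ⟶ X => k.hom.base w) hl).trans hs.symm
    exact (Subtype.ext this : l.hom.base w = s) ▸ hsT
  have hir : subspaceι X U ≫ r = l := by rw [← hl, Category.assoc, hr, Category.comp_id]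
  have A : HomotopicThrough (fun k => subspaceι X U ≫ k = subspaceι X U) (𝟙 X)
      (r ≫ subspaceι X S) := by
    refine ⟨H, h0, h1, fun t => ?_⟩
    change subspaceι X U ≫ _ = subspaceι X U
    rw [← hl, Category.assoc, hH t, Category.comp_id]
  have B : HomotopicThrough (fun k => subspaceι X U ≫ k = subspaceι X U) (r ≫ subspaceι X S)
      (r ≫ (q ≫ subspaceι (subspace X S) T) ≫ subspaceι X S) := by
    have hK' : HomotopicThrough (fun k => subspaceι (subspace X S) T ≫ k =
        subspaceι (subspace X S) T) (𝟙 _) (q ≫ subspaceι (subspace X S) T) :=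
      ⟨K, k0, k1, fun t => (hK t).trans (Category.comp_id _)⟩
    have := (hK'.comp_right (subspaceι X S)).comp_left r
    rw [Category.id_comp] at this
    refine this.mono ?_
    rintro _ ⟨_, ⟨k, hk, rfl⟩, rfl⟩
    rw [← Category.assoc, hir, ← Category.assoc, ← hm, Category.assoc m, hk, hm, hl]
  refine isStrongDeformationRetract_of_homotopicThrough (fun x => ?_) (A.trans B)
  exact ⟨_, subspaceι_base_mem T (q.hom.base (r.hom.base x)), rfl⟩

end Retracts

/-! ## Removing beat points -/

section BeatPoints

variable {X : RingedSpace.{u, u}}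

lemma isIso_res_of_eq {U V : Opens X.carrier} (h : U ≤ V) (h' : V ≤ U) : IsIso (res X h) :=
  ⟨res X h', by rw [res_res, res_refl], by rw [res_res, res_refl]⟩

/-- If the restriction of sections from `B` to `A ∩ B` is an isomorphism, then so is the restriction
from `A ∪ B` to `A`. -/
lemma isIso_res_of_cover {A B D : Opens X.carrier} (hA : A ≤ D) (hB : B ≤ D) (hD : D ≤ A ⊔ B)
    (h : IsIso (res X (inf_le_right : A ⊓ B ≤ B))) : IsIso (res X hA) := by
  -- The inverse extends a section on `A` by the unique section on `B` with the same restriction to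
  -- `A ⊓ B`.
  obtain ⟨c, cA, cB⟩ := exists_glue_sections hA hB hD (𝟙 (sec X A))
    (res X (inf_le_left : A ⊓ B ≤ A) ≫ inv (res X (inf_le_right : A ⊓ B ≤ B)))
    (by rw [Category.assoc, IsIso.inv_hom_id, Category.comp_id, Category.id_comp])
  refine ⟨c, sections_hom_ext hA hB hD ?_ ?_, cA⟩
  · rw [Category.assoc, cA, Category.comp_id, Category.id_comp]
  · rw [Category.assoc, cB, Category.id_comp, ← Category.assoc, IsIso.comp_inv_eq, res_res, res_res]

/-- The sections over the smallest open neighbourhood of a point are the stalk. -/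
lemma isIso_germ_of_smallest {U : Opens X.carrier} {x : X.carrier} (hx : x ∈ U)
    (hU : ∀ V : Opens X.carrier, x ∈ V → U ≤ V) : IsIso (X.presheaf.germ U x hx) := by
  refine (ConcreteCategory.isIso_iff_bijective _).2 ⟨fun s t hst => ?_, fun a => ?_⟩
  · obtain ⟨V, hV, i, j, hij⟩ := TopCat.Presheaf.germ_eq X.presheaf x hx hx s t hst
    obtain rfl : V = U := le_antisymm (leOfHom i) (hU V hV)
    have e : ∀ k : V ⟶ V, X.presheaf.map k.op = 𝟙 _ := fun k => X.presheaf.map_id _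
    rwa [e, e] at hij
  · obtain ⟨V, hV, s, rfl⟩ := TopCat.Presheaf.exists_germ_eq X.presheaf a
    exact ⟨X.presheaf.map (homOfLE (hU V hV)).op s,
      TopCat.Presheaf.germ_res_apply X.presheaf (homOfLE (hU V hV)) x hx s⟩

/-- The smallest open neighbourhood of a point of a finite space. -/
def smallestOpen (x : X.carrier) [Finite X.carrier] : Opens X.carrier :=
  ⟨{y | y ⤳ x}, isOpen_iff_forall_specializes.2 fun _ _ h h' => h.trans h'⟩

lemma smallestOpen_le [Finite X.carrier] {x : X.carrier} {V : Opens X.carrier} (h : x ∈ V) :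
    smallestOpen x ≤ V :=
  fun _ hy => Specializes.mem_open hy V.isOpen h

lemma mem_smallestOpen [Finite X.carrier] (x : X.carrier) : x ∈ smallestOpen x :=
  specializes_rfl

open Classical in
/-- The map that moves `p` to `q` and fixes all other points. -/
def movePoint [Finite X.carrier] (p q : X.carrier)
    (h : ∀ x, x ≠ p → p ⤳ x → q ⤳ x) (h' : ∀ x, x ≠ p → x ⤳ p → x ⤳ q) :
    C(X.carrier, X.carrier) where
  toFun x := if x = p then q else x
  continuous_toFun := by
    refine continuous_def.2 fun V hV => isOpen_iff_forall_specializes.2 fun x y hxy hy => ?_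
    suffices key : (if x = p then q else x) ⤳ (if y = p then q else y) from key.mem_open hV hy
    by_cases hx : x = p <;> by_cases hy : y = p
    · rw [if_pos hx, if_pos hy]
    · rw [if_pos hx, if_neg hy]; exact h y hy (hx ▸ hxy)
    · rw [if_neg hx, if_pos hy]; exact h' x hx (hy ▸ hxy)
    · rwa [if_neg hx, if_neg hy]

lemma movePoint_self [Finite X.carrier] (p q : X.carrier) (h h') :
    movePoint (X := X) p q h h' p = q := if_pos rfl

lemma movePoint_of_ne [Finite X.carrier] (p q : X.carrier) (h h') {x : X.carrier} (hx : x ≠ p) :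
    movePoint (X := X) p q h h' x = x := if_neg hx

/-- Restricted to the complement of `p`, the map `g` and the identity stay comparable and have the
same points, so they coincide. The homotopy given by comparability passes only through these two
maps and is therefore relative to the complement. -/
lemma subspace_compl_retract_aux [Finite X.carrier] {p q : X.carrier} (hq : q ≠ p) {h h'}
    {g : X ⟶ X} (hg : ∀ x, g.hom.base x = movePoint (X := X) p q h h' x)
    (hor : Coarsens g (𝟙 X) ∨ Coarsens (𝟙 X) g) : IsStrongDeformationRetract X {p}ᶜ := by
  have hb : ∀ s : (subspace X {p}ᶜ).carrier, (subspaceι X {p}ᶜ ≫ g).hom.base s =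
      (subspaceι X {p}ᶜ).hom.base s := fun s =>
    (hg _).trans (movePoint_of_ne p q h h' (subspaceι_base_mem _ s))
  have key : subspaceι X {p}ᶜ ≫ g = subspaceι X {p}ᶜ := by
    rcases hor with hor | hor
    · exact ((hor.comp_left (subspaceι X {p}ᶜ)).eq_of_base hb).trans (Category.comp_id _)
    · exact ((hor.comp_left (subspaceι X {p}ᶜ)).eq_of_base fun s => (hb s).symm).symm.trans
        (Category.comp_id _)
  refine isStrongDeformationRetract_of_homotopicThrough (g := g) (fun x => ?_) ?_
  · rw [hg]
    by_cases hx : x = p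
    · rw [hx, movePoint_self]; exact hq
    · rw [movePoint_of_ne _ _ _ _ hx]; exact hx
  · rcases hor with hor | hor
    · refine hor.homotopicThrough.symm.mono ?_
      rintro k (rfl | rfl)
      exacts [key, Category.comp_id _]
    · refine hor.homotopicThrough.mono ?_
      rintro k (rfl | rfl)
      exacts [Category.comp_id _, key]

lemma IsDownBeatPoint.isStrongDeformationRetract [Finite X.carrier] {p : X.carrier}
    (hp : IsDownBeatPoint X p) : IsStrongDeformationRetract X {p}ᶜ := by
  obtain ⟨q, hq, hpq, hmax⟩ := hp
  obtain ⟨g, hg, hgb⟩ := exists_coarsens (𝟙 X)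
    (movePoint p q hmax fun x _ hx => hx.trans hpq) fun x => by
      change x ⤳ _
      by_cases hx : x = p
      · rw [hx, movePoint_self]; exact hpq
      · rw [movePoint_of_ne _ _ _ _ hx]
  exact subspace_compl_retract_aux hq hgb (Or.inl hg)

/-- In the only case with content, `p ∈ D` and `p ∉ V`, so `D = V ∪ U_p` and `V ∩ U_p = U_q`. By the
cover argument it suffices to restrict from `U_p` to `U_q`, and on sections over these smallest open
sets restriction is `r_{pq}`. -/
lemma IsUpBeatPoint.isIso_res [Finite X.carrier] {p q : X.carrier} (hqp : q ⤳ p)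
    (hmin : ∀ q' : X.carrier, q' ≠ p → q' ⤳ p → q' ⤳ q)
    (hiso : IsIso (X.presheaf.stalkSpecializes hqp)) {V D : Opens X.carrier} (hVD : V ≤ D)
    (hD : ∀ x ∈ D, x = p ∨ x ∈ V) (hqV : q ∈ V) : IsIso (res X hVD) := by
  by_cases hpV : p ∈ V
  · exact isIso_res_of_eq hVD fun x hx => (hD x hx).elim (fun e => e ▸ hpV) id
  by_cases hpD : p ∈ D
  swap
  · exact isIso_res_of_eq hVD fun x hx => (hD x hx).elim (fun e => absurd (e ▸ hx) hpD) id
  refine isIso_res_of_cover hVD (smallestOpen_le hpD)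
    (fun x hx => (hD x hx).elim (fun e => Or.inr (e ▸ mem_smallestOpen p)) Or.inl) ?_
  have hq : q ∈ V ⊓ smallestOpen p := ⟨hqV, hqp⟩
  have i1 : IsIso (X.presheaf.germ (smallestOpen p) p (mem_smallestOpen p)) :=
    isIso_germ_of_smallest _ fun W hW => smallestOpen_le hW
  have i2 : IsIso (X.presheaf.germ (V ⊓ smallestOpen p) q hq) :=
    isIso_germ_of_smallest _ fun W hW x hx =>
      (hmin x (fun e => hpV (e ▸ hx.1)) hx.2).mem_open W.isOpen hW
  have e : res X (inf_le_right : V ⊓ smallestOpen p ≤ smallestOpen p) ≫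
      X.presheaf.germ (V ⊓ smallestOpen p) q hq =
      X.presheaf.germ (smallestOpen p) p (mem_smallestOpen p) ≫
        X.presheaf.stalkSpecializes hqp := by
    rw [TopCat.Presheaf.germ_stalkSpecializes]
    exact TopCat.Presheaf.germ_res _ _ _ _
  have : IsIso (res X (inf_le_right : V ⊓ smallestOpen p ≤ smallestOpen p) ≫
      X.presheaf.germ (V ⊓ smallestOpen p) q hq) := e ▸ inferInstance
  exact IsIso.of_isIso_comp_right _ (X.presheaf.germ (V ⊓ smallestOpen p) q hq)

/-- Moving `p` up to `q` enlarges preimages: `V` lies in `b⁻¹ V`, and they differ at most by `p`.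
The sheaf map has to extend sections from `V` to `b⁻¹ V`, which is possible since this restriction
is invertible. -/
lemma IsUpBeatPoint.isStrongDeformationRetract [Finite X.carrier] {p : X.carrier}
    (hp : IsUpBeatPoint X p) : IsStrongDeformationRetract X {p}ᶜ := by
  obtain ⟨q, hqp, hq, hmin, hiso⟩ := hp
  let b := movePoint (X := X) p q (fun x _ hx => hqp.trans hx) hmin
  have hle : ∀ V : Opens X.carrier, V ≤ V.comap b := fun V x hx => by
    change b x ∈ V
    by_cases h : x = p
    · subst h
      rw [movePoint_self]
      exact hqp.mem_open V.isOpen hx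
    · rwa [movePoint_of_ne _ _ _ _ h]
  have hbD : ∀ (V : Opens X.carrier) (x), x ∈ V.comap b → x = p ∨ x ∈ V := fun V x hx => by
    by_cases h : x = p
    · exact Or.inl h
    · have : b x ∈ V := hx
      rw [movePoint_of_ne _ _ _ _ h] at this
      exact Or.inr this
  have isos : ∀ V : Opens X.carrier, IsIso (res X (hle V)) := fun V => by
    by_cases hqV : q ∈ V
    · exact IsUpBeatPoint.isIso_res hqp hmin hiso (hle V) (hbD V) hqV
    · refine isIso_res_of_eq _ fun x hx => (hbD V x hx).elim (fun e => ?_) id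
      have : b x ∈ V := hx
      rw [e, movePoint_self] at this
      exact absurd this hqV
  let g : X ⟶ X := mkHom b (fun V => inv (res X (hle V))) fun V V' h => by
    have h' : V.comap b ≤ V'.comap b := Opens.comap_mono b h
    change _ = _ ≫ res X h'
    rw [IsIso.eq_inv_comp, ← Category.assoc, IsIso.comp_inv_eq, res_res, res_res]
  have hg : Coarsens (𝟙 X) g := by
    refine ⟨fun V => hle V, fun V U hU => ?_⟩
    replace hU : U ≤ V := hU
    rw [appLE_id hU, mkHom_appLE]
    change _ = inv (res X (hle V)) ≫ res X (hU.trans (hle V))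
    rw [IsIso.eq_inv_comp, res_res]
  exact subspace_compl_retract_aux (g := g) hq (h := fun x _ hx => hqp.trans hx) (h' := hmin)
    (fun _ => rfl) (Or.inr hg)

/-- Every ringed finite space has a core. -/
lemma exists_isCore (X : RingedSpace.{u, u}) [Finite X.carrier] : ∃ S, IsCore X S := by
  -- By transitivity of retracts, a retract with fewest points admits no further removal of a point.
  obtain ⟨S, hS, hmin⟩ := Set.exists_min_image {S : Set X.carrier | IsStrongDeformationRetract X S}
    Set.ncard (Set.toFinite _) ⟨Set.univ, isStrongDeformationRetract_univ⟩
  have : Finite (subspace X S).carrier := inferInstanceAs (Finite S)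
  have key : ∀ p : (subspace X S).carrier,
      ¬ IsStrongDeformationRetract (subspace X S) {p}ᶜ := fun p hp => by
    refine (hmin _ (IsStrongDeformationRetract.trans hS hp)).not_gt
      (Set.ncard_lt_ncard ⟨?_, fun hsub => ?_⟩ (Set.toFinite _))
    · rintro _ ⟨s, -, rfl⟩
      exact subspaceι_base_mem S s
    · obtain ⟨s, hs, hsp⟩ := hsub (subspaceι_base_mem S p)
      exact hs (Subtype.ext hsp)
  refine ⟨S, hS, this, ⟨fun x y hxy => ?_⟩, fun p hp => key p hp.isStrongDeformationRetract,
    fun p hp => key p hp.isStrongDeformationRetract⟩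
  by_contra hne
  -- The condition for a down beat point makes sense without `T₀`: of two indistinguishable points,
  -- each is one, with the other as maximum.
  have hbeat : IsDownBeatPoint (subspace X S) x :=
    ⟨y, Ne.symm hne, hxy.specializes, fun z _ hz => hxy.specializes'.trans hz⟩
  exact key x hbeat.isStrongDeformationRetract

end BeatPoints

/-! ## Endomorphisms of minimal ringed finite spaces -/

section Minimal

variable {X Y : RingedSpace.{u, u}}

/-- An endomorphism of a minimal ringed finite space which the identity coarsens is the identity. -/
lemma IsMinimal.eq_id_of_coarsens_id (hX : IsMinimal X) {g : X ⟶ X} (h : Coarsens (𝟙 X) g) :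
    g = 𝟙 X := by
  have := hX.finite
  have := hX.t0
  refine (h.eq_of_base fun x => ?_).symm
  by_contra hne
  -- Among the moved points, `p` has the smallest `U_p`; all other points of `U_p` are then fixed,
  -- and continuity makes `g p` the minimum of `U_p \ {p}`.
  obtain ⟨p, hp, hmin⟩ := Set.exists_min_image {x : X.carrier | g.hom.base x ≠ x}
    (fun x => {y | y ⤳ x}.ncard) (Set.toFinite _) ⟨x, Ne.symm hne⟩
  have hfix : ∀ y, y ≠ p → y ⤳ p → g.hom.base y = y := fun y hy hyp => by
    by_contra hgy
    refine (hmin y hgy).not_gt (Set.ncard_lt_ncard ⟨fun z hz => hz.trans hyp, fun hsub => ?_⟩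
      (Set.toFinite _))
    exact hy (hyp.antisymm (hsub (specializes_refl p))).eq
  have hspec : g.hom.base p ⤳ p := h.specializes p
  have hle : ∀ V : Opens X.carrier, V ≤ pre g V := h.pre_le
  have hres : ∀ V : Opens X.carrier, appTop g V ≫ res X (hle V) = 𝟙 (sec X V) := fun V => by
    have e := h.appLE_eq V V (le_pre_id le_rfl)
    rw [appLE_id le_rfl, res_refl] at e
    exact e.symm
  refine hX.not_up p ⟨g.hom.base p, hspec, hp, fun y hy hyp => ?_, ?_⟩
  · have := hyp.map g.hom.base.hom.continuous
    rwa [show g.hom.base.hom y = y from hfix y hy hyp] at this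
  -- The stalk map of `g` at `p` is inverse to the restriction from `𝒪_p` to `𝒪_{g p}`; on germs
  -- both identities reduce to `hres`.
  · refine ⟨g.hom.stalkMap p, TopCat.Presheaf.stalk_hom_ext _ fun V hV => ?_,
      TopCat.Presheaf.stalk_hom_ext _ fun V hV => ?_⟩
    · have hV' : g.hom.base p ∈ V := hspec.mem_open V.isOpen hV
      have e1 : X.presheaf.germ V (g.hom.base p) hV' ≫ g.hom.stalkMap p =
          appTop g V ≫ X.presheaf.germ (pre g V) p hV' :=
        PresheafedSpace.stalkMap_germ g.hom V p hV'
      have e2 : X.presheaf.germ (pre g V) p hV' =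
          res X (hle V) ≫ X.presheaf.germ V p hV :=
        (TopCat.Presheaf.germ_res _ _ _ _).symm
      rw [TopCat.Presheaf.germ_stalkSpecializes_assoc, Category.comp_id, e1, e2,
        ← Category.assoc, hres, Category.id_comp]
    · have hp' : p ∈ pre g V := hV
      have e1 : X.presheaf.germ V (g.hom.base p) hV ≫ g.hom.stalkMap p =
          appTop g V ≫ X.presheaf.germ (pre g V) p hp' :=
        PresheafedSpace.stalkMap_germ g.hom V p hV
      have hV' : g.hom.base p ∈ pre g V := hle V hV
      have e2 : X.presheaf.germ (pre g V) (g.hom.base p) hV' =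
          res X (hle V) ≫ X.presheaf.germ V (g.hom.base p) hV :=
        (TopCat.Presheaf.germ_res _ _ _ _).symm
      rw [← Category.assoc, e1, Category.assoc, TopCat.Presheaf.germ_stalkSpecializes, e2,
        ← Category.assoc, hres, Category.id_comp, Category.comp_id]

/-- An endomorphism of a minimal ringed finite space which coarsens the identity is the identity. -/
lemma IsMinimal.eq_id_of_id_coarsens (hX : IsMinimal X) {g : X ⟶ X} (h : Coarsens g (𝟙 X)) :
    g = 𝟙 X := by
  have := hX.finite
  have := hX.t0
  refine h.eq_of_base fun x => ?_
  by_contra hne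
  -- Dually, `p` has the smallest closure among the moved points, so `g p` is the maximum of
  -- `closure {p} \ {p}`; no condition on stalks is needed.
  obtain ⟨p, hp, hmin⟩ := Set.exists_min_image {x : X.carrier | g.hom.base x ≠ x}
    (fun x => {y | x ⤳ y}.ncard) (Set.toFinite _) ⟨x, hne⟩
  have hfix : ∀ y, y ≠ p → p ⤳ y → g.hom.base y = y := fun y hy hyp => by
    by_contra hgy
    refine (hmin y hgy).not_gt (Set.ncard_lt_ncard ⟨fun z hz => hyp.trans hz, fun hsub => ?_⟩
      (Set.toFinite _))
    exact hy ((hsub (specializes_refl p)).antisymm hyp).eq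
  refine hX.not_down p ⟨g.hom.base p, hp, h.specializes p, fun y hy hyp => ?_⟩
  have := hyp.map g.hom.base.hom.continuous
  rwa [show g.hom.base.hom y = y from hfix y hy hyp] at this

end Minimal

/-! ## Stalks of the cylinder -/

section Stalks

variable {X Y : RingedSpace.{u, u}}

/-- Morphisms out of a stalk of a ringed space are morphisms of ringed spaces from a skyscraper. -/
lemma exists_skyscraper (E : RingedSpace.{u, u}) (z : E.carrier) (R : CommRingCat.{u}) :
    ∃ (W : RingedSpace.{u, u}) (toSky : (E.presheaf.stalk z ⟶ R) → (W ⟶ E)),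
      Function.Injective toSky ∧ ∀ a b, (toSky a).hom.base = (toSky b).hom.base ∧
        ∀ (T : CommRingCat.{u}) (V : Opens E.carrier) (s : T ⟶ sec E V),
          (∀ hV : z ∈ V, s ≫ E.presheaf.germ V z hV ≫ a = s ≫ E.presheaf.germ V z hV ≫ b) →
          ∀ U ha hb, s ≫ appLE (toSky a) V U ha = s ≫ appLE (toSky b) V U hb := by
  classical
  -- A skyscraper on the same space, with identity on points, turns maps out of the stalk into
  -- morphisms of ringed spaces, to which the universal property of the inverse image applies.
  let W : RingedSpace.{u, u} :=
    { carrier := E.carrier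
      presheaf := skyscraperPresheaf z R
      IsSheaf := skyscraperPresheaf_isSheaf z R }
  let sky : (E.presheaf.stalk z ⟶ R) → (E.presheaf ⟶ skyscraperPresheaf z R) := fun a =>
    StalkSkyscraperPresheafAdjunctionAuxs.toSkyscraperPresheaf z a
  have happ : ∀ (V : Opens E.carrier) (hV : z ∈ V),
      ∃ i : R ⟶ (skyscraperPresheaf z R).obj (op V), ∀ a : E.presheaf.stalk z ⟶ R,
        (sky a).app (op V) = E.presheaf.germ V z hV ≫ a ≫ i :=
    fun V hV => ⟨eqToHom (if_pos hV).symm, fun a => dif_pos hV⟩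
  refine ⟨W, fun a => InducedCategory.homMk { base := 𝟙 E.carrier, c := sky a }, fun a b key => ?_,
    fun a b => ⟨rfl, fun T V s hs U ha hb => ?_⟩⟩
  · have hc : sky a = sky b :=
      eq_of_heq (PresheafedSpace.Hom.mk.inj (congrArg (fun k => k.hom) key)).2
    exact (StalkSkyscraperPresheafAdjunctionAuxs.fromStalk_to_skyscraper z a).symm.trans
      ((congrArg _ hc).trans (StalkSkyscraperPresheafAdjunctionAuxs.fromStalk_to_skyscraper z b))
  · suffices e : s ≫ (sky a).app (op V) = s ≫ (sky b).app (op V) by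
      have e' := congrArg (· ≫ res W ha) e
      exact (Category.assoc _ _ _).symm.trans (e'.trans (Category.assoc _ _ _))
    by_cases hV : z ∈ V
    · obtain ⟨i, hi⟩ := happ _ hV
      have h2 := congrArg (· ≫ i) (hs hV)
      simp only [Category.assoc] at h2
      rw [hi a, hi b, h2]
    · exact ((if_neg hV).symm.ndrec (motive := fun T => Limits.IsTerminal T)
        Limits.terminalIsTerminal).hom_ext _ _

lemma germ_comp_stalkMap (f : X ⟶ Y) (x : X.carrier) (V : Opens Y.carrier) (hx : x ∈ pre f V) :
    Y.presheaf.germ V (f.hom.base x) hx ≫ f.hom.stalkMap x =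
      appTop f V ≫ X.presheaf.germ (pre f V) x hx :=
  PresheafedSpace.stalkMap_germ f.hom V x hx

/-- Morphisms out of a stalk of an inverse image are determined by their composition with the stalk
map of the canonical morphism. -/
lemma inverseImage_stalk_hom_ext {Z : TopCat.{u}} (f : Z ⟶ X.carrier)
    (z : (inverseImage X f).carrier) {R : CommRingCat.{u}}
    {a b : (inverseImage X f).presheaf.stalk z ⟶ R}
    (h : (inverseImageHom X f).hom.stalkMap z ≫ a = (inverseImageHom X f).hom.stalkMap z ≫ b) :
    a = b := by
  obtain ⟨W, toSky, hinj, hsky⟩ := exists_skyscraper (inverseImage X f) z R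
  refine hinj (inverseImage_hom_ext f _ _ (hsky a b).1 (hom_ext_appLE (fun w => ?_)
    fun V ha hb => ?_))
  · exact congrArg (fun k => (inverseImageHom X f).hom.base (k w)) (hsky a b).1
  · have key := (hsky a b).2 _ (pre (inverseImageHom X f) V) (appTop (inverseImageHom X f) V)
      (fun hV => by
        rw [← Category.assoc, ← germ_comp_stalkMap, ← Category.assoc, ← germ_comp_stalkMap,
          Category.assoc, Category.assoc, h]) _ ha hb
    exact (Category.assoc _ _ _).trans (key.trans (Category.assoc _ _ _).symm)

end Stalks

/-! ## Homotopies starting from a morphism -/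

section LocalConstancy

variable {X Y : RingedSpace.{u, u}}

lemma appTop_germ_res (f : X ⟶ Y) {V V' : Opens Y.carrier} (h : V ≤ V') (x : X.carrier)
    (hx : x ∈ pre f V) (hx' : x ∈ pre f V') :
    res Y h ≫ appTop f V ≫ X.presheaf.germ (pre f V) x hx =
      appTop f V' ≫ X.presheaf.germ (pre f V') x hx' := by
  rw [← Category.assoc, res_appTop, Category.assoc]
  exact congrArg (_ ≫ ·) (TopCat.Presheaf.germ_res X.presheaf (homOfLE (pre_mono f h)) x hx)

/-- Stated for a variable `k` in order to be applied to `cylinderAt X t ≫ cylinderProj X`. -/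
lemma appTop_germ_of_eq_id {k : X ⟶ X} (e : k = 𝟙 X) (V : Opens X.carrier) (x : X.carrier)
    (hx : x ∈ pre k V) (hx' : x ∈ V) :
    appTop k V ≫ X.presheaf.germ (pre k V) x hx = X.presheaf.germ V x hx' := by
  subst e
  exact Category.id_comp _

/-- The sections of the sheaf of the cylinder are locally inverse images of sections of the base. -/
lemma exists_germ_cylinderProj (x : X.carrier) (t : unitInterval) {W : Opens (cylinder X).carrier}
    (hx : cylinderPt x t ∈ W) (s : sec (cylinder X) W) :
    ∃ (V : Opens X.carrier) (hV : cylinderPt x t ∈ pre (cylinderProj X) V) (v : sec X V),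
      (cylinder X).presheaf.germ W (cylinderPt x t) hx s =
        (cylinder X).presheaf.germ (pre (cylinderProj X) V) (cylinderPt x t) hV
          (appTop (cylinderProj X) V v) := by
  let z : (cylinder X).carrier := cylinderPt x t
  let σ : X.presheaf.stalk ((cylinderProj X).hom.base z) ⟶ (cylinder X).presheaf.stalk z :=
    (cylinderProj X).hom.stalkMap z
  let ρ : (cylinder X).presheaf.stalk z ⟶ X.presheaf.stalk ((cylinderProj X).hom.base z) :=
    (cylinderAt X t).hom.stalkMap x
  have hσ : ∀ (V : Opens X.carrier) (hV : z ∈ pre (cylinderProj X) V),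
      X.presheaf.germ V ((cylinderProj X).hom.base z) hV ≫ σ =
        appTop (cylinderProj X) V ≫ (cylinder X).presheaf.germ (pre (cylinderProj X) V) z hV :=
    germ_comp_stalkMap (cylinderProj X) z
  have hρ : ∀ (V : Opens (cylinder X).carrier) (hV : z ∈ V),
      (cylinder X).presheaf.germ V z hV ≫ ρ =
        appTop (cylinderAt X t) V ≫ X.presheaf.germ (pre (cylinderAt X t) V)
          ((cylinderProj X).hom.base z) hV :=
    germ_comp_stalkMap (cylinderAt X t) x
  -- The stalk of the cylinder at `(x, t)` is `𝒪_x`: one composite is the identity because `i_t` is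
  -- a section of the projection, the other because maps out of the stalk are determined on the
  -- image of `σ`.
  have hσρ : σ ≫ ρ = 𝟙 _ := TopCat.Presheaf.stalk_hom_ext _
      fun V (hV : z ∈ pre (cylinderProj X) V) => by
    rw [← Category.assoc, hσ V hV, Category.assoc, hρ, ← Category.assoc, Category.comp_id]
    exact appTop_germ_of_eq_id (cylinderAt_proj t) V x hV hV
  have hρσ : ρ ≫ σ = 𝟙 _ := by
    refine inverseImage_stalk_hom_ext (cylinderFst X) z ?_
    change σ ≫ ρ ≫ σ = σ ≫ 𝟙 _
    rw [← Category.assoc, hσρ, Category.id_comp, Category.comp_id]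
  obtain ⟨V, hV, v, hv⟩ := TopCat.Presheaf.exists_germ_eq X.presheaf
    (ρ ((cylinder X).presheaf.germ W z hx s))
  refine ⟨V, hV, v, ?_⟩
  have e1 : σ (ρ ((cylinder X).presheaf.germ W z hx s)) = (cylinder X).presheaf.germ W z hx s :=
    congrArg (fun k => k.hom ((cylinder X).presheaf.germ W z hx s)) hρσ
  have e2 := congrArg (fun k => k.hom v) (hσ V hV)
  exact e1.symm.trans ((congrArg σ hv.symm).trans e2)

/-- The germs at `x` of the restrictions to `X × {t}` of a section on the cylinder are locally
constant in `t`. -/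
lemma eventually_germ_cylinderAt_eq (x : X.carrier) (t₀ : unitInterval)
    {W : Opens (cylinder X).carrier} (h₀ : cylinderPt x t₀ ∈ W) (s : sec (cylinder X) W) :
    ∀ᶠ t in nhds t₀, ∀ h : x ∈ pre (cylinderAt X t) W,
      X.presheaf.germ (pre (cylinderAt X t₀) W) x h₀ (appTop (cylinderAt X t₀) W s) =
        X.presheaf.germ (pre (cylinderAt X t) W) x h (appTop (cylinderAt X t) W s) := by
  obtain ⟨V, hV, v, hv⟩ := exists_germ_cylinderProj x t₀ h₀ s
  obtain ⟨N, hN, iW, iV, hsv⟩ := TopCat.Presheaf.germ_eq _ _ _ _ _ _ hv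
  have hsv' : res (cylinder X) (leOfHom iW) s =
      res (cylinder X) (leOfHom iV) (appTop (cylinderProj X) V v) := hsv
  -- Near `(x, t₀)` the section is pulled back from `v` on the base, so its germ along each slice is
  -- that of `v`, whatever `t`.
  have key : ∀ t (ht : x ∈ pre (cylinderAt X t) N) (h : x ∈ pre (cylinderAt X t) W),
      X.presheaf.germ (pre (cylinderAt X t) W) x h (appTop (cylinderAt X t) W s) =
        X.presheaf.germ V x hV v := fun t ht h => by
    have e1 := congrArg (fun k => k.hom s) (appTop_germ_res (cylinderAt X t) (leOfHom iW) x ht h)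
    have e2 := congrArg (fun k => k.hom (appTop (cylinderProj X) V v))
      (appTop_germ_res (cylinderAt X t) (leOfHom iV) x ht hV)
    have e3 := congrArg (fun k => k.hom v)
      (appTop_germ_of_eq_id (cylinderAt_proj t) V x hV hV)
    have e4 := congrArg (fun a => X.presheaf.germ (pre (cylinderAt X t) N) x ht
      (appTop (cylinderAt X t) N a)) hsv'
    exact e1.symm.trans (e4.trans (e2.trans e3))
  have hcont : Continuous fun t : unitInterval => cylinderPt x t :=
    continuous_cylinderPt continuous_const continuous_id
  filter_upwards [hcont.continuousAt.eventually_mem (N.isOpen.mem_nhds hN)] with t ht h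
  rw [key t ht h, key t₀ hN h₀]

/-- A homotopy between finite spaces: `H_{t₀}` coarsens `H_t` for `t` near `t₀`. -/
lemma eventually_coarsens [Finite X.carrier] [Finite Y.carrier] (H : cylinder X ⟶ Y)
    (t₀ : unitInterval) :
    ∀ᶠ t in nhds t₀, Coarsens (cylinderAt X t₀ ≫ H) (cylinderAt X t ≫ H) := by
  have hspec : ∀ᶠ t in nhds t₀, ∀ x : X.carrier,
      H.hom.base (cylinderPt x t) ⤳ H.hom.base (cylinderPt x t₀) := by
    -- Finiteness of `X` allows one neighbourhood of `t₀` for all `x`; finiteness of `Y` makes the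
    -- generizations of a point open.
    refine Filter.eventually_all.2 fun x => ?_
    have hcont : Continuous fun t : unitInterval => H.hom.base (cylinderPt x t) :=
      H.hom.base.hom.continuous.comp (continuous_cylinderPt continuous_const continuous_id)
    exact hcont.continuousAt.eventually_mem
      ((smallestOpen _).isOpen.mem_nhds (mem_smallestOpen (H.hom.base (cylinderPt x t₀))))
  obtain ⟨ε, hε, hball⟩ := Metric.eventually_nhds_iff_ball.1 hspec
  -- A connected neighbourhood is needed to pass from local constancy of the germs in time to their
  -- constancy.
  have hconn : _root_.IsPreconnected (Metric.ball t₀ ε) := by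
    refine Set.OrdConnected.isPreconnected ⟨fun a ha b hb c hc => ?_⟩
    rw [Metric.mem_ball, Subtype.dist_eq, Real.dist_eq, abs_lt] at *
    have h1 : (a : ℝ) ≤ c := hc.1
    have h2 : (c : ℝ) ≤ b := hc.2
    constructor <;> linarith
  refine Metric.eventually_nhds_iff_ball.2 ⟨ε, hε, fun t ht => ?_⟩
  have hpre : ∀ r ∈ Metric.ball t₀ ε, ∀ V : Opens Y.carrier,
      pre (cylinderAt X t₀ ≫ H) V ≤ pre (cylinderAt X r ≫ H) V := fun r hr V x hx =>
    (hball r hr x).mem_open V.isOpen hx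
  refine ⟨hpre t ht, fun V U hU => ?_⟩
  suffices key : ∀ (s : sec Y V) (x : X.carrier) (hx : x ∈ pre (cylinderAt X t₀ ≫ H) V),
      X.presheaf.germ (pre (cylinderAt X t₀ ≫ H) V) x hx (appTop (cylinderAt X t₀ ≫ H) V s) =
      X.presheaf.germ (pre (cylinderAt X t ≫ H) V) x (hpre t ht V hx)
        (appTop (cylinderAt X t ≫ H) V s) by
    refine CommRingCat.hom_ext (RingHom.ext fun s => ?_)
    refine TopCat.Presheaf.section_ext X.sheaf U _ _ fun x hx => ?_
    have g : ∀ (r : unitInterval) (hr : U ≤ pre (cylinderAt X r ≫ H) V),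
        X.presheaf.germ U x hx ((appLE (cylinderAt X r ≫ H) V U hr).hom s) =
          X.presheaf.germ (pre (cylinderAt X r ≫ H) V) x (hr hx)
            (appTop (cylinderAt X r ≫ H) V s) := fun r hr =>
      TopCat.Presheaf.germ_res_apply X.presheaf (homOfLE hr) x hx _
    exact (g t₀ hU).trans ((key s x (hU hx)).trans (g t (hU.trans (hpre t ht V))).symm)
  intro s x hx
  refine hconn.induction₂ (fun r r' => ∀ (h : x ∈ pre (cylinderAt X r ≫ H) V)
    (h' : x ∈ pre (cylinderAt X r' ≫ H) V),
      X.presheaf.germ (pre (cylinderAt X r ≫ H) V) x h (appTop (cylinderAt X r ≫ H) V s) =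
      X.presheaf.germ (pre (cylinderAt X r' ≫ H) V) x h' (appTop (cylinderAt X r' ≫ H) V s))
    (fun r hr => ?_) (fun a b c _ hb _ hab hbc h h' => ?_) (fun a b _ _ hab h h' => ?_)
    (Metric.mem_ball_self hε) ht hx (hpre t ht V hx)
  · have hr' : cylinderPt x r ∈ pre H V := hpre r hr V hx
    filter_upwards [nhdsWithin_le_nhds (eventually_germ_cylinderAt_eq x r hr' (appTop H V s))]
      with r' h1 _ h' using h1 h'
  · exact (hab h (hpre b hb V hx)).trans (hbc _ h')
  · exact (hab h' h).symm

end LocalConstancy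

/-! ### Rigidity under homotopy and uniqueness of cores -/

section Classification

variable {X Y : RingedSpace.{u, u}}

/-- An endomorphism of a minimal ringed finite space homotopic to the identity is the identity. -/
lemma IsMinimal.eq_id_of_homotopic (hX : IsMinimal X) {f : X ⟶ X} (h : Homotopic f (𝟙 X)) :
    f = 𝟙 X := by
  have := hX.finite
  obtain ⟨H, h0, h1⟩ := h
  have key : ∀ t₀ : unitInterval, ∀ᶠ t in nhds t₀,
      (cylinderAt X t₀ ≫ H = 𝟙 X ↔ cylinderAt X t ≫ H = 𝟙 X) := fun t₀ => by
    filter_upwards [eventually_coarsens H t₀] with t ht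
    -- Since `H_{t₀}` coarsens `H_t`, either one being the identity makes the other comparable with
    -- it. The two directions give openness and closedness of the set of such times.
    exact ⟨fun e => hX.eq_id_of_coarsens_id (e ▸ ht), fun e => hX.eq_id_of_id_coarsens (e ▸ ht)⟩
  have := isPreconnected_univ.induction₂
    (fun t t' : unitInterval => (cylinderAt X t ≫ H = 𝟙 X ↔ cylinderAt X t' ≫ H = 𝟙 X))
    (fun t _ => nhdsWithin_le_nhds (key t)) (fun _ _ _ _ _ _ h h' => h.trans h')
    (fun _ _ _ _ h => h.symm) (Set.mem_univ 1) (Set.mem_univ 0)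
  exact h0.symm.trans (this.1 h1)

/-- A homotopy equivalence between minimal ringed finite spaces is an isomorphism. -/
lemma IsHomotopyEquiv.isIso {f : X ⟶ Y} (hf : IsHomotopyEquiv f) (hX : IsMinimal X)
    (hY : IsMinimal Y) : IsIso f :=
  let ⟨g, h, h'⟩ := hf
  ⟨g, hX.eq_id_of_homotopic h, hY.eq_id_of_homotopic h'⟩

/-- The cores of homotopy equivalent ringed spaces are isomorphic. -/
lemma IsCore.nonempty_iso {S : Set X.carrier} {T : Set Y.carrier} (hS : IsCore X S)
    (hT : IsCore Y T) (h : HomotopyEquivalent X Y) : Nonempty (subspace X S ≅ subspace Y T) := by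
  obtain ⟨f, hf⟩ := h
  obtain ⟨r, hr⟩ := hT.1.isHomotopyEquiv.exists_inverse
  have := ((hS.1.isHomotopyEquiv.comp hf).comp hr).isIso hS.2 hT.2
  exact ⟨asIso ((subspaceι X S ≫ f) ≫ r)⟩

end Classification

end RingedFinite

end

theorem mainTheorem1 :
    -- a homotopy equivalence between minimal ringed finite spaces is an isomorphism
    (∀ (X Y : RingedSpace.{u, u}), RingedFinite.IsMinimal X → RingedFinite.IsMinimal Y →
      ∀ f : X ⟶ Y, RingedFinite.IsHomotopyEquiv f → IsIso f) ∧
    -- every ringed finite space has a core, unique up to isomorphism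
    (∀ X : RingedSpace.{u, u}, Finite X.carrier →
      (∃ S : Set X.carrier, RingedFinite.IsCore X S) ∧
      ∀ S S' : Set X.carrier, RingedFinite.IsCore X S → RingedFinite.IsCore X S' →
        Nonempty (RingedFinite.subspace X S ≅ RingedFinite.subspace X S')) ∧
    -- two ringed finite spaces are homotopy equivalent if and only if their cores are isomorphic
    (∀ X Y : RingedSpace.{u, u}, Finite X.carrier → Finite Y.carrier →
      ∀ (S : Set X.carrier) (T : Set Y.carrier),
        RingedFinite.IsCore X S → RingedFinite.IsCore Y T →
          (RingedFinite.HomotopyEquivalent X Y ↔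
            Nonempty (RingedFinite.subspace X S ≅ RingedFinite.subspace Y T))) := by
  refine ⟨fun X Y hX hY f hf => hf.isIso hX hY, fun X hX => ⟨RingedFinite.exists_isCore X,
    fun S S' hS hS' => hS.nonempty_iso hS' ⟨𝟙 X, RingedFinite.isHomotopyEquiv_of_iso (Iso.refl X)⟩⟩,
    fun X Y _ _ S T hS hT => ⟨fun h => hS.nonempty_iso hT h, fun ⟨e⟩ => ?_⟩⟩
  obtain ⟨r, hr⟩ := hS.1.isHomotopyEquiv.exists_inverse
  exact ⟨_, (hr.comp (RingedFinite.isHomotopyEquiv_of_iso e)).comp hT.1.isHomotopyEquiv⟩
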